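/- All graphs are finite, undirected and simple. For positive integers $k,q$ with $k\ge 2q$, let $G_{k,q}$ be the circular clique: its vertex set is $\{0,1,\dots,k-1\}$, and $ij$ is an edge when $q\le |i-j|\le k-q$. A graph $G$ is *$(k,q)$-mixing* if the graph $\mathscr{C}_{k,q}(G)$ is connected (in particular nonempty), where the vertices of $\mathscr{C}_{k,q}(G)$ are the homomorphisms $G\to G_{k,q}$ and two homomorphisms are adjacent when they differ at exactly one vertex of $G$. In the following definitions $k,q$ range over positive integers with $k\ge 2q$. Put $\chi_c(G)=\inf\{k/q : \text{there is a homomorphism } G\to G_{k,q}\}$, $$\mathfrak{m}_c(G)=\inf\{k/q : k/q\ge\chi_c(G)\text{ and }G\text{ is }(k,q)\text{-mixing}\},$$ $$\mathfrak{M}_c(G)=\inf\{x\in\mathbb{Q} : x\ge\chi_c(G)\text{ and }G\text{ is }(k,q)\text{-mixing for all }k,q\text{ with }k/q\ge x\}.$$ **Proposition.** Let $r\ge 3$ and let $C_r$ be the cycle of length $r$. Then $$\mathfrak{M}_c(C_r)=\begin{cases}2&\text{if }r=4,\\4&\text{otherwise,}\end{cases}\qquad \mathfrak{m}_c(C_r)=\begin{cases}2&\text{if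 }r\text{ is even},\\4&\text{if }r\text{ is odd.}\end{cases}$$ Moreover, if $r\ge 6$ is even, then $C_r$ is $(2q+1,q)$-mixing for every integer $q\ge r/4$, and $C_r$ is not $(4q-1,q)$-mixing for any integer $q\ge 1$. -/

import Mathlib

/-- The circular clique `G_{k,q}` on the vertex set `{0, …, k-1}`, where `ij` is an edge when
`q ≤ |i - j| ≤ k - q`. It is used only for `0 < q` and `2 * q ≤ k`; for `0 < q` the clause
`i ≠ j` is implied by `q ≤ |i - j|`. -/
def circularClique (k q : ℕ) : SimpleGraph (Fin k) where
  Adj i j := i ≠ j ∧ (q : ℤ) ≤ |(i.val : ℤ) - (j.val : ℤ)| ∧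
    |(i.val : ℤ) - (j.val : ℤ)| ≤ (k : ℤ) - (q : ℤ)
  symm := ⟨fun i j h => ⟨h.1.symm, by
    rw [abs_sub_comm (j.val : ℤ) (i.val : ℤ)]; exact h.2⟩⟩
  loopless := ⟨fun _ h => h.1 rfl⟩

/-- The `H`-colour graph of `G`: its vertices are the homomorphisms from `G` to `H`, and two of
them are adjacent when they differ at exactly one vertex of `G`. -/
def colourGraph {V W : Type*} (G : SimpleGraph V) (H : SimpleGraph W) :
    SimpleGraph (G →g H) where
  Adj f g := ∃! v : V, f v ≠ g v
  symm := ⟨fun f g h => by simpa only [ne_comm] using h⟩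
  loopless := ⟨fun _ h => h.exists.elim fun _ hv => hv rfl⟩

/-- `G` is `H`-mixing when the `H`-colour graph of `G` is connected (in particular nonempty). -/
def IsMixing {V W : Type*} (G : SimpleGraph V) (H : SimpleGraph W) : Prop :=
  (colourGraph G H).Connected

/-- `G` is `(k,q)`-mixing when it is `G_{k,q}`-mixing. -/
def IsCircularMixing {V : Type*} (G : SimpleGraph V) (k q : ℕ) : Prop :=
  IsMixing G (circularClique k q)

/-- The circular chromatic number `χ_c(G) = inf {k/q : G → G_{k,q}}`. -/
noncomputable def circularChromaticNumber {V : Type*} (G : SimpleGraph V) : ℝ :=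
  sInf {x : ℝ | ∃ k q : ℕ, 0 < q ∧ 2 * q ≤ k ∧ x = (k : ℝ) / (q : ℝ) ∧
    Nonempty (G →g circularClique k q)}

/-- The circular mixing number
`m_c(G) = inf {k/q : k/q ≥ χ_c(G) and G is (k,q)-mixing}`. -/
noncomputable def circularMixingNumber {V : Type*} (G : SimpleGraph V) : ℝ :=
  sInf {x : ℝ | ∃ k q : ℕ, 0 < q ∧ 2 * q ≤ k ∧ x = (k : ℝ) / (q : ℝ) ∧
    circularChromaticNumber G ≤ x ∧ IsCircularMixing G k q}

/-- The circular mixing threshold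
`M_c(G) = inf {r ∈ ℚ : r ≥ χ_c(G) and G is (k,q)-mixing for all k/q ≥ r}`. -/
noncomputable def circularMixingThreshold {V : Type*} (G : SimpleGraph V) : ℝ :=
  sInf {x : ℝ | ∃ r : ℚ, x = (r : ℝ) ∧ circularChromaticNumber G ≤ x ∧
    ∀ k q : ℕ, 0 < q → 2 * q ≤ k → x ≤ (k : ℝ) / (q : ℝ) → IsCircularMixing G k q}

open SimpleGraph Finset

/-! Going round the cycle, a homomorphism to $G_{k,q}$ has increments in $[q,k-q]$ modulo $k$, with
sum $kW$; conversely any such increments come from a homomorphism. Hence the feasible winding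
numbers $W$ are exactly those with $rq\le kW\le r(k-q)$.

Recolouring one vertex changes two adjacent increments, whose sum stays in $[2q,2k-2q]$ and is fixed
modulo $k$. If $k<4q$, this interval is shorter than $k$ and $W$ is invariant
(`cycleWinding_eq_of_adj`), so two feasible values of $W$ rule out mixing. If $k\ge 4q$, consecutive
values of $W$ can be linked (`exists_reachable_cycleWinding_succ`).

When both bounds on $kW$ are strict, homomorphisms with winding number $W$ are connected: one lift
is raised to another, one unit at a time (`IsCycleLift.reachable_of_le`). For $k\ge 4q$ the extremal
values can be left (`exists_reachable_not_extremal`), which gives mixing. Below 4, everything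
reduces to counting feasible $W$. -/

/-- Two homomorphisms that agree off one vertex are joined in the colour graph. -/
theorem colourGraph_reachable_of_eq_off {V W : Type*} {G : SimpleGraph V} {H : SimpleGraph W}
    {f g : G →g H} (v : V) (h : ∀ w, w ≠ v → f w = g w) : (colourGraph G H).Reachable f g := by
  by_cases hv : f v = g v
  · have : f = g := by
      ext w
      by_cases hw : w = v
      · rw [hw, hv]
      · exact h w hw
    rw [this]
  · exact SimpleGraph.Adj.reachable ⟨v, hv, fun w hw => by_contra fun hne => hw (h w hne)⟩

/-- A function on the cyclic group with total sum zero is a cyclic difference. -/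
theorem exists_cyclic_primitive {m : ℕ} (a : Fin (m + 2) → ℤ) (ha : ∑ i, a i = 0) :
    ∃ b : Fin (m + 2) → ℤ, ∀ i, b (i + 1) - b i = a i := by
  let a' : ℕ → ℤ := fun j => a (Fin.ofNat (m + 2) j)
  have ha' : ∀ i : Fin (m + 2), a' i = a i := fun i => by simp [a']
  have hs : ∑ j ∈ range (m + 2), a' j = 0 := by
    rw [← Fin.sum_univ_eq_sum_range, ← ha]
    exact sum_congr rfl fun i _ => ha' i
  refine ⟨fun i => ∑ j ∈ range i.val, a' j, fun i => ?_⟩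
  simp only [Fin.val_add_one]
  split_ifs with h
  · rw [sum_range_succ] at hs
    subst h
    rw [← ha']
    simp only [range_zero, sum_empty, Fin.val_last]
    linarith
  · rw [sum_range_succ, ha']
    ring

/-- Integers between given bounds attain every intermediate sum. -/
theorem exists_sum_eq_of_bounds {ι : Type*} (s : Finset ι) (lo hi : ι → ℤ)
    (h : ∀ i, lo i ≤ hi i) (S : ℤ) (h1 : ∑ i ∈ s, lo i ≤ S) (h2 : S ≤ ∑ i ∈ s, hi i) :
    ∃ d : ι → ℤ, (∀ i, lo i ≤ d i ∧ d i ≤ hi i) ∧ ∑ i ∈ s, d i = S := by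
  classical
  induction s using Finset.induction_on generalizing S with
  | empty => exact ⟨lo, fun i => ⟨le_rfl, h i⟩, by simp at h1 h2 ⊢; omega⟩
  | insert a s has ih =>
    rw [sum_insert has] at h1 h2
    have hs : ∑ i ∈ s, lo i ≤ ∑ i ∈ s, hi i := sum_le_sum fun i _ => h i
    have ha := h a
    -- The least value at `a` that leaves a remainder not exceeding the upper bounds on `s`.
    obtain ⟨d, hd, hsum⟩ := ih (S - max (lo a) (S - ∑ i ∈ s, hi i)) (by omega) (by omega)
    refine ⟨Function.update d a (max (lo a) (S - ∑ i ∈ s, hi i)), fun i => ?_, ?_⟩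
    · by_cases hi' : i = a
      · subst hi'
        simp only [Function.update_self]
        omega
      · simpa [hi'] using hd i
    · rw [sum_insert has, Function.update_self, sum_update_of_notMem has, hsum]
      ring

/-- The integer labels `x` with carries `n` form a lift of a homomorphism from a cycle to
`G_{k,q}`: every cyclic increment `x (i + 1) - x i + k * n i` lies between `q` and `k - q`. -/
def IsCycleLift {m : ℕ} (k q : ℕ) (x n : Fin (m + 2) → ℤ) : Prop :=
  ∀ i, (q : ℤ) ≤ x (i + 1) - x i + k * n i ∧ x (i + 1) - x i + k * n i ≤ k - q

/-- The number of descents of a cyclic sequence in `Fin k`, which is its winding number. -/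
def cycleWinding {m k : ℕ} (f : Fin (m + 2) → Fin k) : ℤ :=
  ∑ i, if f (i + 1) < f i then 1 else 0

/-! ### Lifts and winding numbers -/

section Lift

variable {m k q : ℕ}

theorem circularClique_adj_emod (hq : 0 < q) {a b : Fin k} {x y c : ℤ}
    (ha : ∃ s, (a.val : ℤ) = x + k * s) (hb : ∃ s, (b.val : ℤ) = y + k * s)
    (h1 : (q : ℤ) ≤ y - x + k * c) (h2 : y - x + k * c ≤ k - q) :
    (circularClique k q).Adj a b := by
  obtain ⟨s, hs⟩ := ha
  obtain ⟨t, ht⟩ := hb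
  have hak := a.isLt
  have hbk := b.isLt
  have key : (b.val : ℤ) - a.val = (y - x + k * c) + k * (t - s - c) := by rw [hs, ht]; ring
  -- Both $b-a$ and the increment are confined to ranges that leave only two possible carries; they
  -- give $|b-a|$ as the increment or as its complement to $k$.
  have hlo : -1 ≤ t - s - c := by
    by_contra hlt
    have : t - s - c ≤ -2 := by omega
    nlinarith
  have hhi : t - s - c ≤ 0 := by
    by_contra hlt
    have : 1 ≤ t - s - c := by omega
    nlinarith
  have hcase : t - s - c = -1 ∨ t - s - c = 0 := by omega
  refine ⟨fun h => ?_, ?_⟩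
  · rw [h] at key
    rcases hcase with h0 | h0 <;> rw [h0] at key <;> omega
  · rcases hcase with h0 | h0 <;> rw [h0] at key <;> constructor <;>
      (try rw [le_abs]) <;> (try rw [abs_le]) <;> omega

/-- The homomorphism determined by a lift. -/
def IsCycleLift.toHom (hq : 0 < q) (hk : 2 * q ≤ k) {x n : Fin (m + 2) → ℤ}
    (h : IsCycleLift k q x n) : cycleGraph (m + 2) →g circularClique k q where
  toFun i := ⟨(x i % k).toNat, by
    have := Int.emod_lt_of_pos (x i) (show (0 : ℤ) < k by omega)
    omega⟩
  map_rel' {i j} hij := by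
    have hm : ∀ i, ∃ s, (((x i % k).toNat : ℕ) : ℤ) = x i + k * s := fun i => by
      have := Int.emod_nonneg (x i) (show (k : ℤ) ≠ 0 by omega)
      exact ⟨-(x i / k), by rw [Int.toNat_of_nonneg this, Int.emod_def]; ring⟩
    rw [cycleGraph_adj] at hij
    rcases hij with hij | hij
    · obtain rfl : i = j + 1 := by rw [← hij]; abel
      exact (circularClique_adj_emod hq (hm j) (hm (j + 1)) (h j).1 (h j).2).symm
    · obtain rfl : j = i + 1 := by rw [← hij]; abel
      exact circularClique_adj_emod hq (hm i) (hm (i + 1)) (h i).1 (h i).2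

theorem IsCycleLift.toHom_val (hq : 0 < q) (hk : 2 * q ≤ k) {x n : Fin (m + 2) → ℤ}
    (h : IsCycleLift k q x n) (i : Fin (m + 2)) : ((h.toHom hq hk i).val : ℤ) = x i % k :=
  Int.toNat_of_nonneg (Int.emod_nonneg (x i) (show (k : ℤ) ≠ 0 by omega))

/-- A homomorphism is its own lift, with a carry at each descent. -/
theorem isCycleLift_hom (f : cycleGraph (m + 2) →g circularClique k q) :
    IsCycleLift k q (fun i => ((f i).val : ℤ)) (fun i => if f (i + 1) < f i then 1 else 0) := by
  intro i
  have hadj : (cycleGraph (m + 2)).Adj (i + 1) i := by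
    rw [cycleGraph_adj]; left; abel
  obtain ⟨h0, h1, h2⟩ := f.map_rel hadj
  rw [le_abs] at h1
  rw [abs_le] at h2
  have h0' : (f (i + 1)).val ≠ (f i).val := fun h => h0 (Fin.ext h)
  simp only [Fin.lt_def]
  split_ifs <;> constructor <;> omega

theorem sum_cyclic_shift (x : Fin (m + 2) → ℤ) : ∑ i, x (i + 1) = ∑ i, x i :=
  Equiv.sum_comp (Equiv.addRight (1 : Fin (m + 2))) x

theorem IsCycleLift.sum_increments {x n : Fin (m + 2) → ℤ} :
    ∑ i, (x (i + 1) - x i + k * n i) = k * ∑ i, n i := by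
  rw [sum_add_distrib, sum_sub_distrib, sum_cyclic_shift, mul_sum]
  ring

theorem IsCycleLift.sum_bounds {x n : Fin (m + 2) → ℤ} (h : IsCycleLift k q x n) :
    ((m + 2 : ℕ) : ℤ) * q ≤ k * ∑ i, n i ∧ k * ∑ i, n i ≤ ((m + 2 : ℕ) : ℤ) * (k - q) := by
  rw [← IsCycleLift.sum_increments (x := x)]
  constructor
  · calc ((m + 2 : ℕ) : ℤ) * q = ∑ _i : Fin (m + 2), (q : ℤ) := by simp
      _ ≤ _ := sum_le_sum fun i _ => (h i).1
  · calc _ ≤ ∑ _i : Fin (m + 2), ((k : ℤ) - q) := sum_le_sum fun i _ => (h i).2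
      _ = _ := by simp; ring

/-- Carries are determined by the residues up to a coboundary. -/
theorem IsCycleLift.carries_eq {x y n n' : Fin (m + 2) → ℤ} (hq : 0 < q)
    (h : IsCycleLift k q x n) (h' : IsCycleLift k q y n') (s : Fin (m + 2) → ℤ)
    (hs : ∀ i, y i = x i + k * s i) (i : Fin (m + 2)) : n i = n' i + s (i + 1) - s i := by
  obtain ⟨h1, h2⟩ := h i
  obtain ⟨h3, h4⟩ := h' i
  rw [hs, hs] at h3 h4
  have key : (k : ℤ) * (n i - (n' i + s (i + 1) - s i)) < k := by linarith
  have key' : (k : ℤ) * (n i - (n' i + s (i + 1) - s i)) > -k := by linarith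
  have : n i - (n' i + s (i + 1) - s i) < 1 := by nlinarith
  have : -1 < n i - (n' i + s (i + 1) - s i) := by nlinarith
  omega

theorem IsCycleLift.cycleWinding_toHom (hq : 0 < q) (hk : 2 * q ≤ k) {x n : Fin (m + 2) → ℤ}
    (h : IsCycleLift k q x n) : cycleWinding (h.toHom hq hk) = ∑ i, n i := by
  -- Reducing labels modulo $k$ changes the carries by a coboundary, which sums to zero.
  have := h.carries_eq hq (isCycleLift_hom (h.toHom hq hk)) (fun i => -(x i / k)) fun i => by
    rw [h.toHom_val, Int.emod_def]; ring
  rw [sum_congr rfl fun i _ => this i, sum_sub_distrib, sum_add_distrib,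
    sum_cyclic_shift fun i => -(x i / (k : ℤ))]
  simp [cycleWinding]

/-- Prescribed cyclic increments with sum `k * W` come from a lift. -/
theorem exists_lift_of_increments (d : Fin (m + 2) → ℤ) (W : ℤ) (hd : ∑ i, d i = k * W)
    (h : ∀ i, (q : ℤ) ≤ d i ∧ d i ≤ k - q) :
    ∃ x n : Fin (m + 2) → ℤ, IsCycleLift k q x n ∧ ∑ i, n i = W ∧
      ∀ i, x (i + 1) - x i + k * n i = d i := by
  let n : Fin (m + 2) → ℤ := fun i => if i = 0 then W else 0
  have hn : ∑ i, n i = W := by simp [n]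
  obtain ⟨x, hx⟩ := exists_cyclic_primitive (fun i => d i - k * n i) (by
    rw [sum_sub_distrib, ← mul_sum, hn, hd, sub_self])
  have hx' : ∀ i, x (i + 1) - x i + k * n i = d i := fun i => by rw [hx]; ring
  exact ⟨x, n, fun i => by rw [hx']; exact h i, hn, hx'⟩

theorem exists_hom_cycleWinding (hq : 0 < q) (hk : 2 * q ≤ k) (W : ℤ)
    (h1 : ((m + 2 : ℕ) : ℤ) * q ≤ k * W) (h2 : k * W ≤ ((m + 2 : ℕ) : ℤ) * (k - q)) :
    ∃ f : cycleGraph (m + 2) →g circularClique k q, cycleWinding f = W := by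
  obtain ⟨d, hd, hsum⟩ := exists_sum_eq_of_bounds (univ : Finset (Fin (m + 2)))
    (fun _ => (q : ℤ)) (fun _ => k - q) (fun _ => by omega) (k * W) (by simpa using h1)
    (by simpa [mul_sub] using h2)
  obtain ⟨x, n, h, hn, -⟩ := exists_lift_of_increments d W hsum hd
  exact ⟨h.toHom hq hk, (h.cycleWinding_toHom hq hk).trans hn⟩

theorem cycleWinding_bounds (f : cycleGraph (m + 2) →g circularClique k q) :
    ((m + 2 : ℕ) : ℤ) * q ≤ k * cycleWinding f ∧
      k * cycleWinding f ≤ ((m + 2 : ℕ) : ℤ) * (k - q) :=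
  (isCycleLift_hom f).sum_bounds

/-! ### Invariance of the winding number below 4 -/

/-- For `k < 4 * q` the winding number is constant on the components of the colour graph. -/
theorem cycleWinding_eq_of_adj (hkq : k < 4 * q)
    {f g : cycleGraph (m + 2) →g circularClique k q}
    (h : (colourGraph _ _).Adj f g) : cycleWinding f = cycleWinding g := by
  obtain ⟨i, -, hi⟩ := h
  have hfg : ∀ j, j ≠ i → f j = g j := fun j hj => by_contra fun h => hj (hi j h)
  have hne : i + 1 ≠ i := by simp
  have hne' : i - 1 ≠ i := by simp
  have hf1 := isCycleLift_hom f i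
  have hf2 := isCycleLift_hom f (i - 1)
  have hg1 := isCycleLift_hom g i
  have hg2 := isCycleLift_hom g (i - 1)
  simp only [sub_add_cancel] at hf2 hg2
  rw [← sub_eq_zero, cycleWinding, cycleWinding, ← sum_sub_distrib,
    Fintype.sum_eq_add i (i - 1) hne'.symm]
  · simp only [sub_add_cancel]
    beta_reduce at hf1 hg1
    rw [hfg _ hne] at hf1 ⊢
    rw [hfg _ hne'] at hf2 ⊢
    generalize (if g (i + 1) < f i then (1 : ℤ) else 0) = a at *
    generalize (if g (i + 1) < g i then (1 : ℤ) else 0) = b at *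
    generalize (if f i < g (i - 1) then (1 : ℤ) else 0) = c at *
    generalize (if g i < g (i - 1) then (1 : ℤ) else 0) = d at *
    have hkq' : (k : ℤ) < 4 * q := by exact_mod_cast hkq
    -- The two increments at `i` have, before and after, sums in $[2q,2k-2q]$ that differ by this
    -- multiple of $k$; the interval has length $2k-4q<k$.
    have hlt : (k : ℤ) * (a - b + (c - d)) < k := by linarith
    have hgt : -(k : ℤ) < k * (a - b + (c - d)) := by linarith
    have : a - b + (c - d) < 1 := by nlinarith
    have : -1 < a - b + (c - d) := by nlinarith
    omega
  · rintro j ⟨hj, hj'⟩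
    rw [hfg j hj, hfg (j + 1) fun h => hj' (eq_sub_of_add_eq h), sub_self]

theorem not_isCircularMixing_of_cycleWinding (hq : 0 < q) (hk : 2 * q ≤ k) (hkq : k < 4 * q)
    {W W' : ℤ} (hW : W ≠ W')
    (h1 : ((m + 2 : ℕ) : ℤ) * q ≤ k * W) (h2 : k * W ≤ ((m + 2 : ℕ) : ℤ) * (k - q))
    (h1' : ((m + 2 : ℕ) : ℤ) * q ≤ k * W') (h2' : k * W' ≤ ((m + 2 : ℕ) : ℤ) * (k - q)) :
    ¬ IsCircularMixing (cycleGraph (m + 2)) k q := by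
  intro hmix
  obtain ⟨f, rfl⟩ := exists_hom_cycleWinding hq hk W h1 h2
  obtain ⟨g, rfl⟩ := exists_hom_cycleWinding hq hk W' h1' h2'
  obtain ⟨p⟩ := hmix.preconnected f g
  apply hW
  clear * - p hkq
  induction p with
  | nil => rfl
  | cons h _ ih => exact (cycleWinding_eq_of_adj hkq h).trans ih

/-! ### Connectedness at a fixed winding number -/

/-- Changing a lift at one position gives a homomorphism in the same component. -/
theorem IsCycleLift.reachable_of_eq_off (hq : 0 < q) (hk : 2 * q ≤ k)
    {x y n n' : Fin (m + 2) → ℤ} (hx : IsCycleLift k q x n) (hy : IsCycleLift k q y n')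
    (i : Fin (m + 2)) (h : ∀ j, j ≠ i → x j = y j) :
    (colourGraph _ _).Reachable (hx.toHom hq hk) (hy.toHom hq hk) :=
  colourGraph_reachable_of_eq_off i fun j hj => Fin.ext <| by
    zify
    rw [hx.toHom_val, hy.toHom_val, h j hj]

/-- Two lifts with the same carries, one below the other, give homomorphisms in the same
component unless all increments are extremal. -/
theorem IsCycleLift.reachable_of_le (hq : 0 < q) (hk : 2 * q ≤ k) {x y n : Fin (m + 2) → ℤ}
    (hx : IsCycleLift k q x n) (hy : IsCycleLift k q y n)
    (h1 : ((m + 2 : ℕ) : ℤ) * q < k * ∑ i, n i) (h2 : k * ∑ i, n i < ((m + 2 : ℕ) : ℤ) * (k - q))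
    (hxy : ∀ i, x i ≤ y i) :
    (colourGraph _ _).Reachable (hx.toHom hq hk) (hy.toHom hq hk) := by
  obtain ⟨N, hN⟩ : ∃ N : ℕ, ∑ i, (y i - x i) ≤ N := ⟨_, Int.self_le_toNat _⟩
  induction N generalizing x with
  | zero =>
    have hz : ∀ i, x i = y i := fun i => by
      have h0 : ∀ i ∈ univ, 0 ≤ y i - x i := fun i _ => by linarith [hxy i]
      have := (sum_eq_zero_iff_of_nonneg h0).1 (le_antisymm (by simpa using hN) (sum_nonneg h0)) i
        (mem_univ i)
      omega
    obtain rfl : x = y := funext hz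
    rfl
  | succ N ih =>
    by_cases hex : ∃ i, x i < y i
    swap
    · push Not at hex
      obtain rfl : x = y := funext fun i => le_antisymm (hxy i) (hex i)
      rfl
    -- A label is blocked from rising when its outgoing increment is $q$ or its incoming one is
    -- $k-q$. Either way the neighbour responsible also lies below its target and, by strictness of
    -- the bounds, has smaller `H`. So a minimiser of `H` among the labels still to be raised is
    -- free.
    obtain ⟨H, hH⟩ := exists_cyclic_primitive
      (fun i => ((m + 2 : ℕ) : ℤ) * (x (i + 1) - x i + k * n i) - k * ∑ j, n j) (by
        rw [sum_sub_distrib, ← mul_sum, IsCycleLift.sum_increments]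
        simp)
    obtain ⟨i, hi, hmin⟩ := (univ.filter fun i => x i < y i).exists_min_image H (by
      obtain ⟨i, hi⟩ := hex
      exact ⟨i, by simpa using hi⟩)
    simp only [mem_filter, mem_univ, true_and] at hi hmin
    have hne : i + 1 ≠ i := by simp
    have hright : (q : ℤ) < x (i + 1) - x i + k * n i := by
      refine lt_of_le_of_ne (hx i).1 fun heq => ?_
      have hlt : x (i + 1) < y (i + 1) := by linarith [(hy i).1]
      have := hmin _ hlt
      have := hH i
      rw [← heq] at this
      linarith
    have hleft : x i - x (i - 1) + k * n (i - 1) < k - q := by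
      have hb := hx (i - 1)
      have hb' := hy (i - 1)
      have hH' := hH (i - 1)
      simp only [sub_add_cancel] at hb hb' hH'
      refine lt_of_le_of_ne hb.2 fun heq => ?_
      have hlt : x (i - 1) < y (i - 1) := by linarith
      have := hmin _ hlt
      rw [heq] at hH'
      linarith
    have hx' : IsCycleLift k q (Function.update x i (x i + 1)) n := by
      intro j
      have hj := hx j
      by_cases hji : j = i
      · subst hji
        rw [Function.update_of_ne hne, Function.update_self]
        omega
      · rw [Function.update_of_ne hji]
        by_cases hji' : j + 1 = i
        · obtain rfl : j = i - 1 := eq_sub_of_add_eq hji'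
          simp only [sub_add_cancel, Function.update_self] at hj ⊢
          omega
        · rw [Function.update_of_ne hji']
          exact hj
    refine (hx.reachable_of_eq_off hq hk hx' i fun j hj => ?_).trans (ih hx' (fun j => ?_) ?_)
    · rw [Function.update_of_ne hj]
    · by_cases hji : j = i
      · subst hji
        rw [Function.update_self]
        omega
      · rw [Function.update_of_ne hji]
        exact hxy j
    · have : ∑ j, Function.update x i (x i + 1) j = ∑ j, x j + 1 := by
        rw [sum_update_of_mem (mem_univ i), ← add_sum_erase _ _ (mem_univ i), erase_eq]
        ring
      rw [sum_sub_distrib] at hN ⊢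
      rw [this]
      push_cast at hN
      linarith

theorem toHom_isCycleLift_hom (hq : 0 < q) (hk : 2 * q ≤ k)
    (f : cycleGraph (m + 2) →g circularClique k q) : (isCycleLift_hom f).toHom hq hk = f := by
  ext i
  zify
  rw [IsCycleLift.toHom_val]
  exact Int.emod_eq_of_lt (by positivity) (by exact_mod_cast (f i).isLt)

/-- Homomorphisms with the same non-extremal winding number are in the same component. -/
theorem reachable_of_cycleWinding_eq (hq : 0 < q) (hk : 2 * q ≤ k)
    {f g : cycleGraph (m + 2) →g circularClique k q} (hfg : cycleWinding f = cycleWinding g)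
    (h1 : ((m + 2 : ℕ) : ℤ) * q < k * cycleWinding f)
    (h2 : k * cycleWinding f < ((m + 2 : ℕ) : ℤ) * (k - q)) :
    (colourGraph _ _).Reachable f g := by
  set nf : Fin (m + 2) → ℤ := fun i => if f (i + 1) < f i then 1 else 0 with hnf
  set ng : Fin (m + 2) → ℤ := fun i => if g (i + 1) < g i then 1 else 0 with hng
  have hf : IsCycleLift k q (fun i => ((f i).val : ℤ)) nf := isCycleLift_hom f
  have hg : IsCycleLift k q (fun i => ((g i).val : ℤ)) ng := isCycleLift_hom g
  obtain ⟨s, hs⟩ := exists_cyclic_primitive (fun i => ng i - nf i) (by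
    rw [sum_sub_distrib]
    exact sub_eq_zero.2 hfg.symm)
  obtain ⟨i₀, hi₀⟩ := Finite.exists_min s
  -- Adding $k$ times `s` gives `g` the carries of `f`; the constant makes every shift at least $k$,
  -- which puts this lift above that of `f`.
  have hy : IsCycleLift k q (fun i => ((g i).val : ℤ) + k * (s i - s i₀ + 1)) nf := by
    intro i
    have hi := hg i
    have : ((g (i + 1)).val : ℤ) + k * (s (i + 1) - s i₀ + 1) -
        ((g i).val + k * (s i - s i₀ + 1)) + k * nf i =
        ((g (i + 1)).val : ℤ) - (g i).val + k * ng i := by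
      linear_combination (k : ℤ) * hs i
    simp only [this]
    exact hi
  have hr := hf.reachable_of_le hq hk hy h1 h2 fun i => by
    have hlt := (f i).isLt
    have : (k : ℤ) * 1 ≤ k * (s i - s i₀ + 1) :=
      mul_le_mul_of_nonneg_left (by linarith [hi₀ i]) (by positivity)
    omega
  have e1 : hf.toHom hq hk = f := toHom_isCycleLift_hom hq hk f
  have e2 : hy.toHom hq hk = g := by
    ext i
    zify
    rw [IsCycleLift.toHom_val, Int.add_mul_emod_self_left]
    exact Int.emod_eq_of_lt (by positivity) (by exact_mod_cast (g i).isLt)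
  rwa [e1, e2] at hr

/-! ### Changing the winding number when $k\ge 4q$ -/

/-- Two consecutive increments of a lift can be replaced by any admissible pair whose sum is the
same modulo `k`. -/
theorem IsCycleLift.exists_reachable_cycleWinding_add (hq : 0 < q) (hk : 2 * q ≤ k)
    {x n : Fin (m + 2) → ℤ} (h : IsCycleLift k q x n) (i : Fin (m + 2)) (ε e₁ e₂ : ℤ)
    (h₁ : q ≤ e₁ ∧ e₁ ≤ k - q) (h₂ : q ≤ e₂ ∧ e₂ ≤ k - q)
    (he : e₁ + e₂ = x (i + 1) - x (i - 1) + k * (n i + n (i - 1)) + k * ε) :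
    ∃ g, (colourGraph _ _).Reachable (h.toHom hq hk) g ∧ cycleWinding g = ∑ j, n j + ε := by
  have hne : i + 1 ≠ i := by simp
  have hne' : i - 1 ≠ i := by simp
  have hy : IsCycleLift k q (Function.update x i (x (i + 1) + k * n i + k * ε - e₁))
      (Function.update n i (n i + ε)) := by
    intro j
    by_cases hji : j = i
    · subst hji
      rw [Function.update_of_ne hne, Function.update_self, Function.update_self]
      have : x (j + 1) - (x (j + 1) + k * n j + k * ε - e₁) + k * (n j + ε) = e₁ := by ring
      rw [this]
      exact h₁
    · rw [Function.update_of_ne hji, Function.update_of_ne hji]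
      by_cases hji' : j + 1 = i
      · obtain rfl : j = i - 1 := eq_sub_of_add_eq hji'
        simp only [sub_add_cancel, Function.update_self]
        have : x (i + 1) + k * n i + k * ε - e₁ - x (i - 1) + k * n (i - 1) = e₂ := by
          linear_combination -he
        rw [this]
        exact h₂
      · rw [Function.update_of_ne hji']
        exact h j
  refine ⟨hy.toHom hq hk, h.reachable_of_eq_off hq hk hy i fun j hj => ?_, ?_⟩
  · rw [Function.update_of_ne hj]
  · rw [hy.cycleWinding_toHom, sum_update_of_mem (mem_univ i),
      ← add_sum_erase _ _ (mem_univ i), erase_eq]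
    ring

/-- For `4 * q ≤ k`, consecutive feasible winding numbers occur in a common component. -/
theorem exists_reachable_cycleWinding_succ (hq : 0 < q) (hkq : 4 * q ≤ k) (W : ℤ)
    (h1 : ((m + 2 : ℕ) : ℤ) * q ≤ k * W) (h2 : k * (W + 1) ≤ ((m + 2 : ℕ) : ℤ) * (k - q)) :
    ∃ f g : cycleGraph (m + 2) →g circularClique k q, (colourGraph _ _).Reachable f g ∧
      cycleWinding f = W ∧ cycleWinding g = W + 1 := by
  -- The caps force `d 0 = q` and `d 1 ≤ k - 3 * q`, so that the pair can become `d 0 + d 1 + q`, `k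
  -- - q`, with sum larger by $k$. They lower the maximal total by exactly $k$, which the bound on
  -- $k(W+1)$ allows.
  obtain ⟨d, hd, hsum⟩ := exists_sum_eq_of_bounds (univ : Finset (Fin (m + 2)))
    (fun _ => (q : ℤ))
    (fun j => k - q - (if j = 0 then (k : ℤ) - 2 * q else 0) - if j = 1 then 2 * (q : ℤ) else 0)
    (fun j => by
      by_cases h0 : j = 0
      · simp [h0]; omega
      · by_cases h1 : j = 1
        · simp [h1]; omega
        · simp [h0, h1]; omega) (k * W) (by simpa using h1) (by
      rw [sum_sub_distrib, sum_sub_distrib, sum_ite_eq', sum_ite_eq']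
      simp only [sum_const, card_univ, Fintype.card_fin, mem_univ, if_true, nsmul_eq_mul]
      linarith)
  have hd0 := hd 0
  have hd1 := hd 1
  simp at hd0 hd1
  obtain ⟨x, n, h, hn, hx⟩ := exists_lift_of_increments d W hsum fun j => by
    refine ⟨(hd j).1, (hd j).2.trans ?_⟩
    split_ifs <;> omega
  have hk : 2 * q ≤ k := by omega
  have hx0 := hx 0
  have hx1 := hx 1
  rw [zero_add] at hx0
  obtain ⟨g, hg, hgW⟩ := h.exists_reachable_cycleWinding_add hq hk 1 1 (k - q) (d 0 + d 1 + q)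
    ⟨by omega, by omega⟩ ⟨by omega, by omega⟩ (by
      rw [sub_self]
      linear_combination -hx0 - hx1)
  exact ⟨_, g, hg, (h.cycleWinding_toHom hq hk).trans hn, by rw [hgW, hn]⟩

/-- For `4 * q ≤ k`, homomorphisms with non-extremal winding numbers are in one component. -/
theorem reachable_of_cycleWinding_le (hq : 0 < q) (hkq : 4 * q ≤ k)
    {f g : cycleGraph (m + 2) →g circularClique k q} (hfg : cycleWinding f ≤ cycleWinding g)
    (h1 : ((m + 2 : ℕ) : ℤ) * q < k * cycleWinding f)
    (h2 : k * cycleWinding g < ((m + 2 : ℕ) : ℤ) * (k - q)) :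
    (colourGraph _ _).Reachable f g := by
  have hk : 2 * q ≤ k := by omega
  obtain ⟨t, ht⟩ : ∃ t : ℕ, cycleWinding g = cycleWinding f + t :=
    ⟨(cycleWinding g - cycleWinding f).toNat, by omega⟩
  induction t generalizing f with
  | zero =>
    have he : cycleWinding f = cycleWinding g := by simpa using ht.symm
    exact reachable_of_cycleWinding_eq hq hk he h1 (he ▸ h2)
  | succ t ih =>
    push_cast at ht
    have hle : (k : ℤ) * (cycleWinding f + 1) ≤ k * cycleWinding g :=
      mul_le_mul_of_nonneg_left (by omega) (by positivity)
    obtain ⟨f', g', hr, hf', hg'⟩ := exists_reachable_cycleWinding_succ (m := m) hq hkq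
      (cycleWinding f) h1.le (hle.trans h2.le)
    have hk0 : (0 : ℤ) < k := by omega
    exact (reachable_of_cycleWinding_eq hq hk hf'.symm h1 (by linarith)).trans
      (hr.trans (ih (by omega) (by rw [hg']; linarith) (by omega)))

/-- For `4 * q ≤ k`, every component contains a non-extremal winding number. -/
theorem exists_reachable_not_extremal (hq : 0 < q) (hkq : 4 * q ≤ k) (hm : 1 ≤ m)
    (f : cycleGraph (m + 2) →g circularClique k q) :
    ∃ g, (colourGraph _ _).Reachable f g ∧ ((m + 2 : ℕ) : ℤ) * q < k * cycleWinding g ∧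
      k * cycleWinding g < ((m + 2 : ℕ) : ℤ) * (k - q) := by
  have hk : 2 * q ≤ k := by omega
  have hf := isCycleLift_hom f
  have hsum : ∑ i, (((f (i + 1)).val : ℤ) - (f i).val +
      k * (if f (i + 1) < f i then (1 : ℤ) else 0)) = k * cycleWinding f :=
    IsCycleLift.sum_increments (x := fun i => ((f i).val : ℤ))
      (n := fun i => if f (i + 1) < f i then 1 else 0)
  obtain ⟨hlo, hhi⟩ := cycleWinding_bounds f
  -- The range of $kW$ is longer than $k$, so one step inward from either end lands strictly inside.
  have hgap : (k : ℤ) < ((m + 2 : ℕ) : ℤ) * (k - 2 * q) := by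
    have : (3 : ℤ) * (k - 2 * q) ≤ ((m + 2 : ℕ) : ℤ) * (k - 2 * q) :=
      mul_le_mul_of_nonneg_right (by omega) (by omega)
    omega
  have hfe := toHom_isCycleLift_hom hq hk f
  rcases hlo.lt_or_eq with hlo' | hlo'
  · rcases hhi.lt_or_eq with hhi' | hhi'
    · exact ⟨f, .refl f, hlo', hhi'⟩
    · have hall : ∀ i, (k : ℤ) - q - (((f (i + 1)).val : ℤ) - (f i).val +
          k * (if f (i + 1) < f i then (1 : ℤ) else 0)) = 0 := fun i =>
        (sum_eq_zero_iff_of_nonneg fun i _ => sub_nonneg.2 (hf i).2).1 (by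
          rw [sum_sub_distrib, hsum, hhi']
          simp [mul_sub]) i (mem_univ i)
      have ha := hall 0
      have hb := hall (0 - 1)
      rw [sub_add_cancel] at hb
      -- All increments are $k-q$ here; two of them sum to $2k-2q$, and $k$ less is $q+(k-3q)$.
      obtain ⟨g, hg, hgW⟩ := hf.exists_reachable_cycleWinding_add hq hk 0 (-1) q (k - 3 * q)
        ⟨by omega, by omega⟩ ⟨by omega, by omega⟩ (by
          simp only [sub_add_cancel]
          linear_combination ha + hb)
      rw [hfe] at hg
      have hgW' : cycleWinding g = cycleWinding f + -1 := hgW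
      exact ⟨g, hg, by rw [hgW']; linarith, by rw [hgW']; linarith⟩
  · have hall : ∀ i, (((f (i + 1)).val : ℤ) - (f i).val +
        k * (if f (i + 1) < f i then (1 : ℤ) else 0)) - q = 0 := fun i =>
      (sum_eq_zero_iff_of_nonneg fun i _ => sub_nonneg.2 (hf i).1).1 (by
        rw [sum_sub_distrib, hsum, ← hlo']
        simp) i (mem_univ i)
    have ha := hall 0
    have hb := hall (0 - 1)
    rw [sub_add_cancel] at hb
    obtain ⟨g, hg, hgW⟩ := hf.exists_reachable_cycleWinding_add hq hk 0 1 (k - q) (3 * q)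
      ⟨by omega, by omega⟩ ⟨by omega, by omega⟩ (by
        simp only [sub_add_cancel]
        linear_combination -ha - hb)
    rw [hfe] at hg
    have hgW' : cycleWinding g = cycleWinding f + 1 := hgW
    exact ⟨g, hg, by rw [hgW']; linarith, by rw [hgW']; linarith⟩

end Lift

/-! ### Mixing and non-mixing of cycles -/

section Mixing

variable {r k q : ℕ}

/-- Cycles are `(k,q)`-mixing when `k / q ≥ 4`. -/
theorem cycleGraph_isCircularMixing_of_four_mul_le (hr : 3 ≤ r) (hq : 0 < q) (hkq : 4 * q ≤ k) :
    IsCircularMixing (cycleGraph r) k q := by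
  obtain ⟨m, rfl⟩ : ∃ m, r = m + 2 := ⟨r - 2, by omega⟩
  have hk : 2 * q ≤ k := by omega
  obtain ⟨f₀, -⟩ : ∃ f : cycleGraph (m + 2) →g circularClique k q,
      cycleWinding f = ((m + 2) / 2 : ℕ) := by
    obtain ⟨s, hs⟩ : ∃ s : ℕ, s = (m + 2) / 2 := ⟨_, rfl⟩
    rw [← hs]
    have hs1 : ((m + 2 : ℕ) : ℤ) ≤ 4 * s := by omega
    have hs2 : 2 * (s : ℤ) ≤ ((m + 2 : ℕ) : ℤ) := by omega
    have hkq' : 4 * (q : ℤ) ≤ k := by exact_mod_cast hkq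
    have hs0 : (0 : ℤ) ≤ s := by positivity
    have hq0 : (0 : ℤ) ≤ q := by positivity
    exact exists_hom_cycleWinding hq hk s (by nlinarith) (by nlinarith)
  refine (connected_iff _).2 ⟨fun f g => ?_, ⟨f₀⟩⟩
  obtain ⟨f', hf, hf1, hf2⟩ := exists_reachable_not_extremal hq hkq (by omega) f
  obtain ⟨g', hg, hg1, hg2⟩ := exists_reachable_not_extremal hq hkq (by omega) g
  refine hf.trans (Reachable.trans ?_ hg.symm)
  rcases le_total (cycleWinding f') (cycleWinding g') with h | h
  · exact reachable_of_cycleWinding_le hq hkq h hf1 hg2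
  · exact (reachable_of_cycleWinding_le hq hkq h hg1 hf2).symm

/-- An even cycle is `(k,q)`-mixing when `k > 2 * q` and only half its length is a feasible
winding number. -/
theorem cycleGraph_isCircularMixing_of_even {s : ℕ} (hs : 0 < s) (hq : 0 < q) (hk : 2 * q < k)
    (h : ∀ W : ℤ, ((2 * s : ℕ) : ℤ) * q ≤ k * W → k * W ≤ ((2 * s : ℕ) : ℤ) * (k - q) → W = s) :
    IsCircularMixing (cycleGraph (2 * s)) k q := by
  obtain ⟨m, hm⟩ : ∃ m, 2 * s = m + 2 := ⟨2 * s - 2, by omega⟩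
  have hs' : (0 : ℤ) < s := by exact_mod_cast hs
  have hk' : 2 * (q : ℤ) < k := by exact_mod_cast hk
  have h1 : ((2 * s : ℕ) : ℤ) * q < k * s := by push_cast; nlinarith
  have h2 : k * (s : ℤ) < ((2 * s : ℕ) : ℤ) * (k - q) := by push_cast; nlinarith
  rw [hm] at h h1 h2 ⊢
  obtain ⟨f₀, -⟩ := exists_hom_cycleWinding hq hk.le s h1.le h2.le
  have hW : ∀ f : cycleGraph (m + 2) →g circularClique k q, cycleWinding f = s := fun f =>
    h _ (cycleWinding_bounds f).1 (cycleWinding_bounds f).2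
  exact (connected_iff _).2 ⟨fun f g => reachable_of_cycleWinding_eq hq hk.le ((hW f).trans (hW g).symm)
    (by rwa [hW f]) (by rwa [hW f]), ⟨f₀⟩⟩

/-- With $r=2s$ and $k=2q+1$, feasibility reads $(2q+1)|W-s|\le s$, and $s\le 2q$ forces $W=s$. -/
theorem cycleGraph_isCircularMixing_two_mul_add_one (hr : 3 ≤ r) (he : Even r)
    (hrq : r ≤ 4 * q) : IsCircularMixing (cycleGraph r) (2 * q + 1) q := by
  obtain ⟨s, rfl⟩ := even_iff_two_dvd.1 he
  refine cycleGraph_isCircularMixing_of_even (by omega) (by omega) (by omega) fun W h1 h2 => ?_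
  push_cast at h1 h2
  have hsq : (s : ℤ) ≤ 2 * q := by omega
  have hlo : (s : ℤ) - 1 < W := by nlinarith
  have hhi : W < (s : ℤ) + 1 := by nlinarith
  omega

theorem cycleGraph_four_isCircularMixing (hq : 0 < q) (hk : 2 * q < k) :
    IsCircularMixing (cycleGraph 4) k q := by
  by_cases hkq : 4 * q ≤ k
  · exact cycleGraph_isCircularMixing_of_four_mul_le (by norm_num) hq hkq
  · refine cycleGraph_isCircularMixing_of_even (s := 2) (by norm_num) hq hk fun W h1 h2 => ?_
    push_cast at h1 h2 ⊢
    have hkq' : (k : ℤ) < 4 * q := by omega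
    have hlo : 1 < W := by nlinarith
    have hhi : W < 3 := by nlinarith
    omega

/-- Feasibility is symmetric under $W\mapsto r-W$, which has no fixed point for odd $r$. -/
theorem cycleGraph_not_isCircularMixing_of_odd (hr : 3 ≤ r) (ho : ¬ Even r) (hq : 0 < q)
    (hk : 2 * q ≤ k) (hkq : k < 4 * q) : ¬ IsCircularMixing (cycleGraph r) k q := by
  intro hmix
  obtain ⟨m, rfl⟩ : ∃ m, r = m + 2 := ⟨r - 2, by omega⟩
  obtain ⟨f⟩ := hmix.nonempty
  obtain ⟨h1, h2⟩ := cycleWinding_bounds f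
  refine not_isCircularMixing_of_cycleWinding hq hk hkq (W := cycleWinding f)
    (W' := ((m + 2 : ℕ) : ℤ) - cycleWinding f) (fun h => ho ?_) h1 h2 (by linarith)
    (by linarith) hmix
  have : Even ((m + 2 : ℕ) : ℤ) := ⟨cycleWinding f, by omega⟩
  exact_mod_cast this

/-- With $r=2s$, both $s$ and $s+1$ are feasible: the latter needs $s(2q-1)\ge 4q-1$, which holds
for $s\ge 3$. -/
theorem cycleGraph_not_isCircularMixing_of_even (hr : 6 ≤ r) (he : Even r) (hq : 1 ≤ q) :
    ¬ IsCircularMixing (cycleGraph r) (4 * q - 1) q := by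
  obtain ⟨s, rfl⟩ := even_iff_two_dvd.1 he
  obtain ⟨m, hm⟩ : ∃ m, 2 * s = m + 2 := ⟨2 * s - 2, by omega⟩
  have hk : ((4 * q - 1 : ℕ) : ℤ) = 4 * q - 1 := by omega
  have hm' : ((m + 2 : ℕ) : ℤ) = 2 * s := by omega
  have hs : (3 : ℤ) ≤ s := by omega
  have hq' : (1 : ℤ) ≤ q := by exact_mod_cast hq
  rw [hm]
  apply not_isCircularMixing_of_cycleWinding (W := s) (W' := s + 1) (by omega) (by omega)
    (by omega) (by omega) <;> rw [hk, hm'] <;> nlinarith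

end Mixing

/-! ### Bounds for the infima -/

section Numbers

variable {V : Type*} {G : SimpleGraph V}

theorem two_le_div_of_two_mul_le {k q : ℕ} (hq : 0 < q) (hk : 2 * q ≤ k) :
    (2 : ℝ) ≤ k / q := by
  rw [le_div_iff₀ (by exact_mod_cast hq)]
  exact_mod_cast hk

theorem circularChromaticNumber_le {k q : ℕ} (hq : 0 < q) (hk : 2 * q ≤ k)
    (f : G →g circularClique k q) : circularChromaticNumber G ≤ k / q :=
  csInf_le ⟨2, by rintro _ ⟨k, q, hq, hk, rfl, -⟩; exact two_le_div_of_two_mul_le hq hk⟩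
    ⟨k, q, hq, hk, rfl, ⟨f⟩⟩

theorem two_le_circularChromaticNumber {k q : ℕ} (hq : 0 < q) (hk : 2 * q ≤ k)
    (f : G →g circularClique k q) : 2 ≤ circularChromaticNumber G :=
  le_csInf ⟨_, k, q, hq, hk, rfl, ⟨f⟩⟩ (by
    rintro _ ⟨k, q, hq, hk, rfl, -⟩; exact two_le_div_of_two_mul_le hq hk)

theorem circularMixingNumber_le {k q : ℕ} (hq : 0 < q) (hk : 2 * q ≤ k)
    (h : IsCircularMixing G k q) : circularMixingNumber G ≤ k / q := by
  obtain ⟨f⟩ := h.nonempty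
  exact csInf_le ⟨2, by rintro _ ⟨k, q, hq, hk, rfl, -⟩; exact two_le_div_of_two_mul_le hq hk⟩
    ⟨k, q, hq, hk, rfl, circularChromaticNumber_le hq hk f, h⟩

/-- The mixing pair only shows that the set is nonempty, since `sInf ∅ = 0` in the reals. -/
theorem le_circularMixingNumber {k q : ℕ} (hq : 0 < q) (hk : 2 * q ≤ k)
    (h : IsCircularMixing G k q) {c : ℝ} (hc : ∀ k q : ℕ, 0 < q → 2 * q ≤ k →
      IsCircularMixing G k q → c ≤ k / q) : c ≤ circularMixingNumber G := by
  obtain ⟨f⟩ := h.nonempty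
  refine le_csInf ⟨_, k, q, hq, hk, rfl, circularChromaticNumber_le hq hk f, h⟩ ?_
  rintro _ ⟨k, q, hq, hk, rfl, -, h⟩
  exact hc k q hq hk h

theorem circularMixingThreshold_le (x : ℚ) (hx : 2 ≤ x) (h : ∀ k q : ℕ, 0 < q → 2 * q ≤ k →
    (x : ℝ) ≤ (k : ℝ) / (q : ℝ) → IsCircularMixing G k q) : circularMixingThreshold G ≤ x := by
  have hnum : x = (x.num.toNat : ℕ) / (x.den : ℕ) := by
    have hn : 0 ≤ x.num := Rat.num_nonneg.2 (by linarith)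
    have : ((x.num.toNat : ℕ) : ℚ) = x.num := by exact_mod_cast Int.toNat_of_nonneg hn
    rw [this, Rat.num_div_den]
  have hk : 2 * x.den ≤ x.num.toNat := by
    rw [hnum, le_div_iff₀ (by exact_mod_cast x.den_pos)] at hx
    exact_mod_cast hx
  have hxr : (x : ℝ) = (x.num.toNat : ℕ) / (x.den : ℕ) := by
    simpa only [Rat.cast_div, Rat.cast_natCast] using congrArg (Rat.cast : ℚ → ℝ) hnum
  -- Mixing at `x` itself, in lowest terms, supplies the homomorphism that gives $\chi_c\le x$.
  obtain ⟨f⟩ := (h _ _ x.den_pos hk hxr.le).nonempty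
  have hχ := two_le_circularChromaticNumber x.den_pos hk f
  refine csInf_le ⟨2, by rintro _ ⟨y, rfl, hy, -⟩; exact hχ.trans hy⟩ ⟨x, rfl, ?_, h⟩
  rw [hxr]
  exact circularChromaticNumber_le x.den_pos hk f

theorem le_circularMixingThreshold {k q : ℕ} (hq : 0 < q) (hk : 2 * q ≤ k)
    (h : ∀ k' q' : ℕ, 0 < q' → 2 * q' ≤ k' → (k : ℝ) / (q : ℝ) ≤ (k' : ℝ) / (q' : ℝ) →
      IsCircularMixing G k' q') {c : ℝ} (hc : ∀ x : ℝ, 2 ≤ x → (∀ k q : ℕ, 0 < q → 2 * q ≤ k →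
      x ≤ (k : ℝ) / (q : ℝ) → IsCircularMixing G k q) → c ≤ x) :
    c ≤ circularMixingThreshold G := by
  obtain ⟨f⟩ := (h k q hq hk le_rfl).nonempty
  refine le_csInf ⟨_, k / q, by push_cast; rfl, circularChromaticNumber_le hq hk f, h⟩ ?_
  rintro _ ⟨x, rfl, hx, hmix⟩
  exact hc x ((two_le_circularChromaticNumber hq hk f).trans hx) hmix

end Numbers

/-! ### The values for cycles -/

section CycleNumbers

variable {r : ℕ}

theorem cycleGraph_isCircularMixing_of_four_le_div (hr : 3 ≤ r) {k q : ℕ} (hq : 0 < q)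
    (h : (4 : ℝ) ≤ k / q) : IsCircularMixing (cycleGraph r) k q := by
  rw [le_div_iff₀ (by exact_mod_cast hq)] at h
  exact cycleGraph_isCircularMixing_of_four_mul_le hr hq (by exact_mod_cast h)

theorem circularMixingThreshold_cycleGraph_four : circularMixingThreshold (cycleGraph 4) = 2 := by
  apply le_antisymm
  -- The mixing result for $C_4$ requires $k/q>2$, so 2 is approached through rationals above it.
  · refine le_of_forall_gt_imp_ge_of_dense fun y hy => ?_
    obtain ⟨x, hx2, hxy⟩ := exists_rat_btwn hy
    refine (circularMixingThreshold_le x (by exact_mod_cast hx2.le) fun k q hq _ hkq =>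
      cycleGraph_four_isCircularMixing hq ?_).trans hxy.le
    have := hx2.trans_le hkq
    rw [lt_div_iff₀ (by exact_mod_cast hq)] at this
    exact_mod_cast this
  · refine le_circularMixingThreshold (k := 4) (q := 1) (by norm_num) (by norm_num)
      (fun k q hq _ h => ?_) fun x hx _ => hx
    exact cycleGraph_isCircularMixing_of_four_le_div (by norm_num) hq (by simpa using h)

theorem circularMixingThreshold_cycleGraph (hr : 3 ≤ r) (hr4 : r ≠ 4) :
    circularMixingThreshold (cycleGraph r) = 4 := by
  apply le_antisymm
  · have := circularMixingThreshold_le (G := cycleGraph r) 4 (by norm_num) fun k q hq _ h =>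
      cycleGraph_isCircularMixing_of_four_le_div hr hq (by simpa using h)
    simpa using this
  · refine le_circularMixingThreshold (k := 4) (q := 1) (by norm_num) (by norm_num)
      (fun k q hq _ h => cycleGraph_isCircularMixing_of_four_le_div hr hq (by simpa using h))
      fun x _ hmix => ?_
    by_contra! hx
    -- This makes $(4q-1)/q=4-1/q$ exceed $x$.
    obtain ⟨q, hqx⟩ := exists_nat_gt (1 / (4 - x))
    have hx4 : 0 < 4 - x := by linarith
    have hq0 : (0 : ℝ) < q := (by positivity : (0 : ℝ) < 1 / (4 - x)).trans hqx
    have hq : 0 < q := by exact_mod_cast hq0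
    rw [div_lt_iff₀ hx4] at hqx
    have hnot : ¬ IsCircularMixing (cycleGraph r) (4 * q - 1) q := by
      by_cases he : Even r
      · refine cycleGraph_not_isCircularMixing_of_even ?_ he hq
        obtain ⟨s, rfl⟩ := he
        omega
      · exact cycleGraph_not_isCircularMixing_of_odd hr he hq (by omega) (by omega)
    refine hnot (hmix _ _ hq (by omega) ?_)
    rw [le_div_iff₀ hq0, Nat.cast_sub (by omega)]
    push_cast
    linarith

theorem circularMixingNumber_cycleGraph_of_even (hr : 3 ≤ r) (he : Even r) :
    circularMixingNumber (cycleGraph r) = 2 := by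
  apply le_antisymm
  · refine le_of_forall_pos_le_add fun ε hε => ?_
    -- Then $(2q+1)/q=2+1/q<2+\varepsilon$, and $q>r$ ensures $r\le 4q$.
    obtain ⟨q, hq⟩ := exists_nat_gt (max (1 / ε) r)
    have hqε := (le_max_left _ _).trans_lt hq
    have hqr : r < q := by exact_mod_cast (le_max_right _ _).trans_lt hq
    have hq0 : (0 : ℝ) < q := by exact_mod_cast (by omega : 0 < q)
    refine (circularMixingNumber_le (k := 2 * q + 1) (q := q) (by omega) (by omega)
      (cycleGraph_isCircularMixing_two_mul_add_one hr he (by omega))).trans ?_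
    rw [div_lt_iff₀ hε] at hqε
    rw [div_le_iff₀ hq0]
    push_cast
    linarith
  · exact le_circularMixingNumber (k := 4) (q := 1) (by norm_num) (by norm_num)
      (cycleGraph_isCircularMixing_of_four_mul_le hr (by norm_num) (by norm_num))
      fun k q hq hk _ => two_le_div_of_two_mul_le hq hk

theorem circularMixingNumber_cycleGraph_of_odd (hr : 3 ≤ r) (ho : ¬ Even r) :
    circularMixingNumber (cycleGraph r) = 4 := by
  have h4 : IsCircularMixing (cycleGraph r) 4 1 :=
    cycleGraph_isCircularMixing_of_four_mul_le hr (by norm_num) (by norm_num)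
  apply le_antisymm
  · have := circularMixingNumber_le (by norm_num) (by norm_num) h4
    simpa using this
  · refine le_circularMixingNumber (k := 4) (q := 1) (by norm_num) (by norm_num) h4
      fun k q hq hk h => ?_
    rw [le_div_iff₀ (by exact_mod_cast hq)]
    by_contra! hlt
    exact cycleGraph_not_isCircularMixing_of_odd hr ho hq hk (by exact_mod_cast hlt) h

end CycleNumbers

theorem mainTheorem10 (r : ℕ) (hr : 3 ≤ r) :
    circularMixingThreshold (SimpleGraph.cycleGraph r) = (if r = 4 then 2 else 4) ∧
    circularMixingNumber (SimpleGraph.cycleGraph r) = (if Even r then 2 else 4) ∧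
    (Even r → 6 ≤ r →
      (∀ q : ℕ, (r : ℝ) / 4 ≤ (q : ℝ) →
        IsCircularMixing (SimpleGraph.cycleGraph r) (2 * q + 1) q) ∧
      (∀ q : ℕ, 1 ≤ q →
        ¬ IsCircularMixing (SimpleGraph.cycleGraph r) (4 * q - 1) q)) := by
  refine ⟨?_, ?_, fun he hr6 => ⟨fun q hq => ?_, fun q hq =>
    cycleGraph_not_isCircularMixing_of_even hr6 he hq⟩⟩
  · split_ifs with h
    · rw [h, circularMixingThreshold_cycleGraph_four]
    · exact circularMixingThreshold_cycleGraph hr h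
  · split_ifs with h
    · exact circularMixingNumber_cycleGraph_of_even hr h
    · exact circularMixingNumber_cycleGraph_of_odd hr h
  · refine cycleGraph_isCircularMixing_two_mul_add_one hr he ?_
    rw [div_le_iff₀ (by norm_num)] at hq
    have : r ≤ q * 4 := by exact_mod_cast hq
    omega
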